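/- For integers $s_1\ge 1$, $s_2\ge 2$ let $$\zeta_2(s_1,s_2)=\sum_{0<m<n}\frac{1}{m^{s_1}n^{s_2}},$$ and for integers $s_1,s_2,s_3\ge 2$ let $$\zeta_3(s_1,s_2,s_3)=\sum_{0<l<m<n}\frac{1}{l^{s_1}m^{s_2}n^{s_3}}.$$ Let $\zeta$ be the Riemann zeta-function (so $\zeta(0)=-\tfrac12$) and let $[x]$ denote the integer part of $x$. **Theorem.** For all integers $a,b,c\ge 2$, \begin{align*} &(1+(-1)^a)\zeta_3(a,b,c)+(1+(-1)^b)\{\zeta_3(b,a,c)+\zeta_3(b,c,a)\}+(-1)^b(1+(-1)^c)\zeta_3(c,b,a)\\ &=2\bigg\{\sum_{\xi=0}^{[a/2]}\zeta(2\xi)\sum_{\omega=0}^{a-2\xi}\binom{\omega+b-1}{\omega}\binom{a+c-2\xi-\omega-1}{c-1}\zeta_2(b+\omega,a+c-2\xi-\omega)\\ &\quad+\sum_{\xi=0}^{[b/2]}\zeta(2\xi)\sum_{\omega=0}^{a-1}\binom{\omega+b-2\xi}{\omega}\binom{a+c-\omega-2}{c-1}\zeta_2(b-2\xi+\omega+1,a+c-1-\omega)\\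 &\quad+(-1)^b\sum_{\xi=0}^{[c/2]}\zeta(2\xi)\sum_{\omega=0}^{c-2\xi}\binom{\omega+b-1}{\omega}\binom{a+c-2\xi-\omega-1}{a-1}\zeta_2(b+\omega,a+c-2\xi-\omega)\\ &\quad+(-1)^b\sum_{\xi=0}^{[b/2]}\zeta(2\xi)\sum_{\omega=0}^{c-1}\binom{\omega+b-2\xi}{\omega}\binom{a+c-\omega-2}{a-1}\zeta_2(b-2\xi+\omega+1,a+c-1-\omega)\bigg\}\\ &\quad-\zeta_2(a+b,c)-(1+(-1)^b)\zeta_2(b,a+c)-(-1)^b\zeta_2(b+c,a). \end{align*} -/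

import Mathlib

/-- The Euler-Zagier double zeta value
`ζ₂(a, b) = ∑_{0 < m < n} 1 / (m ^ a * n ^ b)`: the first argument is the exponent of the
smaller summation variable. -/
noncomputable def doubleZeta (a b : ℕ) : ℂ :=
  ∑' p : {p : ℕ × ℕ // 0 < p.1 ∧ p.1 < p.2},
    1 / ((p.1.1 : ℂ) ^ a * (p.1.2 : ℂ) ^ b)

/-- The Euler-Zagier triple zeta value
`ζ₃(a, b, c) = ∑_{0 < l < m < n} 1 / (l ^ a * m ^ b * n ^ c)`: the first argument is the exponent
of the smallest summation variable. -/
noncomputable def tripleZeta (a b c : ℕ) : ℂ :=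
  ∑' p : {p : ℕ × ℕ × ℕ // 0 < p.1 ∧ p.1 < p.2.1 ∧ p.2.1 < p.2.2},
    1 / ((p.1.1 : ℂ) ^ a * (p.1.2.1 : ℂ) ^ b * (p.1.2.2 : ℂ) ^ c)

/-- The series defining `doubleZeta a b` converges absolutely for `a ≥ 1`, `b ≥ 2`. -/
theorem summable_doubleZeta {a b : ℕ} (ha : 1 ≤ a) (hb : 2 ≤ b) :
    Summable fun p : {p : ℕ × ℕ // 0 < p.1 ∧ p.1 < p.2} =>
      1 / ((p.1.1 : ℂ) ^ a * (p.1.2 : ℂ) ^ b) := by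
  have h0 : Summable fun n : ℕ => 1 / (n : ℝ) ^ (3 / 2 : ℝ) :=
    Real.summable_one_div_nat_rpow.2 (by norm_num)
  have h1 : Summable fun p : ℕ × ℕ =>
      1 / (p.1 : ℝ) ^ (3 / 2 : ℝ) * (1 / (p.2 : ℝ) ^ (3 / 2 : ℝ)) :=
    h0.mul_of_nonneg h0 (fun n => by positivity) (fun n => by positivity)
  refine Summable.of_norm_bounded (h1.subtype _) ?_
  rintro ⟨⟨m, n⟩, hm, hmn⟩
  simp only at hm hmn
  have hm1 : (1 : ℝ) ≤ m := by exact_mod_cast hm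
  have hn1 : (m : ℝ) ≤ n := by exact_mod_cast hmn.le
  have hm0 : (0 : ℝ) < m := by linarith
  have hn0 : (0 : ℝ) < n := by linarith
  simp only [norm_div, norm_mul, norm_pow, norm_one, Complex.norm_natCast, Function.comp_apply]
  rw [← one_div_mul_one_div_rev, mul_comm, one_div_mul_one_div_rev, one_div_mul_one_div_rev,
    mul_comm ((n : ℝ) ^ b)]
  refine one_div_le_one_div_of_le (by positivity) ?_
  have e1 : (m : ℝ) ^ (3 / 2 : ℝ) = m * (m : ℝ) ^ (1 / 2 : ℝ) := by
    rw [show (3 / 2 : ℝ) = 1 + 1 / 2 by norm_num, Real.rpow_add hm0, Real.rpow_one]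
  have e2 : (n : ℝ) ^ (1 / 2 : ℝ) * (n : ℝ) ^ (3 / 2 : ℝ) = (n : ℝ) ^ 2 := by
    rw [← Real.rpow_add hn0, ← Real.rpow_natCast]; norm_num
  have e3 : (m : ℝ) ^ (1 / 2 : ℝ) ≤ (n : ℝ) ^ (1 / 2 : ℝ) := by gcongr
  have e4 : (m : ℝ) ≤ (m : ℝ) ^ a := by simpa using pow_le_pow_right₀ hm1 ha
  have e5 : (n : ℝ) ^ 2 ≤ (n : ℝ) ^ b := pow_le_pow_right₀ (by linarith) hb
  calc (n : ℝ) ^ (3 / 2 : ℝ) * (m : ℝ) ^ (3 / 2 : ℝ)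
      = m * ((m : ℝ) ^ (1 / 2 : ℝ) * (n : ℝ) ^ (3 / 2 : ℝ)) := by rw [e1]; ring
    _ ≤ m * ((n : ℝ) ^ (1 / 2 : ℝ) * (n : ℝ) ^ (3 / 2 : ℝ)) := by gcongr
    _ = m * (n : ℝ) ^ 2 := by rw [e2]
    _ ≤ (m : ℝ) ^ a * (n : ℝ) ^ b := by gcongr

/-- The series defining `tripleZeta a b c` converges absolutely for `a, b, c ≥ 2`. -/
theorem summable_tripleZeta {a b c : ℕ} (ha : 2 ≤ a) (hb : 2 ≤ b) (hc : 2 ≤ c) :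
    Summable fun p : {p : ℕ × ℕ × ℕ // 0 < p.1 ∧ p.1 < p.2.1 ∧ p.2.1 < p.2.2} =>
      1 / ((p.1.1 : ℂ) ^ a * (p.1.2.1 : ℂ) ^ b * (p.1.2.2 : ℂ) ^ c) := by
  have h : ∀ k : ℕ, 2 ≤ k → Summable fun n : ℕ => 1 / (n : ℝ) ^ k := fun k hk =>
    Real.summable_one_div_nat_pow.2 hk
  have h1 : Summable fun p : ℕ × ℕ × ℕ =>
      1 / (p.1 : ℝ) ^ a * (1 / (p.2.1 : ℝ) ^ b * (1 / (p.2.2 : ℝ) ^ c)) :=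
    (h a ha).mul_of_nonneg
      ((h b hb).mul_of_nonneg (h c hc) (fun n => by positivity) (fun n => by positivity))
      (fun n => by positivity) (fun n => by positivity)
  refine Summable.of_norm_bounded (h1.subtype _) ?_
  rintro ⟨⟨l, m, n⟩, hp⟩
  simp only [norm_div, norm_mul, norm_pow, norm_one, Complex.norm_natCast, Function.comp_apply]
  apply le_of_eq
  simp only [one_div, mul_inv]
  ring

/-!
For fixed `0 < m < n` consider `f(t) = t ^ (-a) * (m - t) ^ (-b) * (n - t) ^ (-c)` and sum it over
all integers `l` other than the poles `0`, `m`, `n`. The identity comes from summing the result over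
all pairs `m < n` in two ways.

* Summing over `(l, m, n)` region by region: `l < 0` and `l > n` give, up to sign, `ζ₃(a, b, c)` and
  `ζ₃(c, b, a)`; `0 < l < m` and `m < l < n` give, up to sign, the products `ζ(a) ζ₂(b, c)` and
  `ζ(c) ζ₂(b, a)`, which the stuffle decomposition (`hasSum_stuffle`) turns into triple and double
  zeta values. The total is `hasSum_threePole_pairs`.
* Summing over `l` first: by the residue theorem applied to `π cot(π t) f(t)`, the sum is minus
  the sum of the residues at `0`, `m`, `n`. Since `π t cot(π t) = -2 ∑ ζ(2ξ) t ^ (2ξ)`, each residue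
  is `-2` times a coefficient of `∑ ζ(2ξ) X ^ (2ξ)` times the Taylor series of the regular part of `f`.
  No complex analysis is used: `hasSum_threePole` proves this evaluation by induction on the
  exponents. Both sides satisfy the recursion coming from
  `p - q = (t - q) - (t - p)`, and it ends at a single pole, where the sum is
  `∑ (l - p) ^ (-a)`, taken symmetrically because of the case `a = 1`.

The coefficients at `0` and `n` are sums of `m ^ (-s) n ^ (-t)` and of `(n - m) ^ (-s) n ^ (-t)`.
The coefficient at `m` involves `m ^ (-s) (n - m) ^ (-t)`, which partial fractions
(`pow_mul_pow_eq_sum_add_sum`) reduce to the same two kinds; see `neg_one_pow_mul_polarSum`.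
Summation over `m < n`, with the reflection `m ↦ n - m` for the second kind, leaves double zeta
values.
-/

open Filter Topology SummationFilter

/-! ### Symmetric sums of inverse powers over the integers -/

theorem sum_Icc_comp_sub_one {M : Type*} [AddCommGroup M] (f : ℤ → M) (N : ℕ) :
    ∑ l ∈ Finset.Icc (-(N : ℤ)) N, f (l - 1)
      = ∑ l ∈ Finset.Icc (-(N : ℤ)) N, f l + f (-N - 1) - f N := by
  induction N with
  | zero => simp
  | succ N ih =>
    have key : ∀ g : ℤ → M, ∑ l ∈ Finset.Icc (-((N + 1 : ℕ) : ℤ)) ((N + 1 : ℕ) : ℤ), g l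
        = ∑ l ∈ Finset.Icc (-(N : ℤ)) N, g l + g (-(N + 1 : ℤ)) + g (N + 1) := by
      intro g
      have : Finset.Icc (-((N + 1 : ℕ) : ℤ)) ((N + 1 : ℕ) : ℤ)
          = insert (N + 1 : ℤ) (insert (-(N + 1 : ℤ)) (Finset.Icc (-(N : ℤ)) N)) := by
        ext x; simp only [Finset.mem_Icc, Finset.mem_insert]; push_cast; omega
      rw [this, Finset.sum_insert, Finset.sum_insert]
      · abel
      · simp
      · simp only [Finset.mem_insert, Finset.mem_Icc]; omega
    rw [key (fun l => f (l - 1)), key f, ih]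
    push_cast
    rw [show (N + 1 - 1 : ℤ) = N by ring, show -(N : ℤ) - 1 = -(N + 1) by ring]
    abel

theorem hasSum_symmetricIcc_comp_sub_one {f : ℤ → ℂ} {s : ℂ} (hf : HasSum f s (symmetricIcc ℤ))
    (h1 : Tendsto (fun N : ℕ => f (-N - 1)) atTop (𝓝 0))
    (h2 : Tendsto (fun N : ℕ => f N) atTop (𝓝 0)) :
    HasSum (fun l => f (l - 1)) s (symmetricIcc ℤ) := by
  rw [hasSum_symmetricIcc_iff] at hf ⊢
  simpa [sum_Icc_comp_sub_one] using (hf.add h1).sub h2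

theorem hasSum_symmetricIcc_of_comp_sub_one {f : ℤ → ℂ} {s : ℂ}
    (hf : HasSum (fun l => f (l - 1)) s (symmetricIcc ℤ))
    (h1 : Tendsto (fun N : ℕ => f (-N - 1)) atTop (𝓝 0))
    (h2 : Tendsto (fun N : ℕ => f N) atTop (𝓝 0)) :
    HasSum f s (symmetricIcc ℤ) := by
  rw [hasSum_symmetricIcc_iff] at hf ⊢
  have h := (hf.sub h1).add h2
  simp only [sum_Icc_comp_sub_one, sub_zero, add_zero] at h
  exact h.congr fun N => by ring

theorem tendsto_inv_intCast_sub (p : ℤ) :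
    Tendsto (fun l : ℤ => ((l : ℂ) - p)⁻¹) cofinite (𝓝 0) := by
  have h : Tendsto (fun l : ℤ => l - p) cofinite cofinite :=
    sub_left_injective.tendsto_cofinite
  have h' := tendsto_inv₀_cobounded.comp
    (Metric.cobounded_eq_cocompact (α := ℝ) ▸ Int.tendsto_coe_cofinite.comp h)
  rw [tendsto_zero_iff_norm_tendsto_zero] at h' ⊢
  refine h'.congr fun l => ?_
  simp only [Function.comp_apply, norm_inv]
  rw [← Int.cast_sub, Complex.norm_intCast, Real.norm_eq_abs]

/-- The symmetric sum of `1 / (l - p)` over the integers vanishes (the term `l = p` is `0⁻¹ = 0`):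
this is oddness for `p = 0`, and a shift by one changes the partial sums by two terms that tend to
zero. -/
theorem hasSum_inv_intCast_sub (p : ℤ) :
    HasSum (fun l : ℤ => ((l : ℂ) - p)⁻¹) 0 (symmetricIcc ℤ) := by
  have h1 : ∀ p : ℤ, Tendsto (fun N : ℕ => (((-N - 1 : ℤ) : ℂ) - p)⁻¹) atTop (𝓝 0) := fun p => by
    have : Function.Injective (fun N : ℕ => (-N - 1 : ℤ)) := fun x y h => by
      simp only at h; omega
    exact (tendsto_inv_intCast_sub p).comp (Nat.cofinite_eq_atTop ▸ this.tendsto_cofinite)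
  have h2 : ∀ p : ℤ, Tendsto (fun N : ℕ => (((N : ℤ) : ℂ) - p)⁻¹) atTop (𝓝 0) := fun p =>
    (tendsto_inv_intCast_sub p).comp
      (Nat.cofinite_eq_atTop ▸ (Nat.cast_injective (R := ℤ)).tendsto_cofinite)
  induction p using Int.induction_on with
  | zero =>
    rw [hasSum_symmetricIcc_iff]
    have : ∀ N : ℕ, ∑ l ∈ Finset.Icc (-(N : ℤ)) N, ((l : ℂ) - (0 : ℤ))⁻¹ = 0 := by
      intro N
      have h := Finset.sum_nbij' (s := Finset.Icc (-(N : ℤ)) N) (t := Finset.Icc (-(N : ℤ)) N)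
        (f := fun l : ℤ => ((l : ℂ) - (0 : ℤ))⁻¹) (g := fun l : ℤ => -((l : ℂ) - (0 : ℤ))⁻¹)
        (fun l => -l) (fun l => -l) (by simp; omega) (by simp; omega) (by simp) (by simp)
        (fun l _ => by simp [← inv_neg])
      rw [Finset.sum_neg_distrib] at h
      exact self_eq_neg.mp h
    simp only [this, tendsto_const_nhds]
  | succ p ih =>
    convert hasSum_symmetricIcc_comp_sub_one ih (h1 p) (h2 p) using 3
    push_cast; ring
  | pred p ih =>
    refine hasSum_symmetricIcc_of_comp_sub_one (f := fun l : ℤ => ((l : ℂ) - (-p - 1 : ℤ))⁻¹)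
      ?_ (h1 _) (h2 _)
    convert ih using 3
    push_cast; ring

/-- The value is `2 ζ(a)` or `0` according to the parity of `a`; symmetric summation is needed only
for `a = 1`. -/
theorem hasSum_inv_intCast_sub_pow (p : ℤ) {a : ℕ} (ha : 1 ≤ a) :
    HasSum (fun l : ℤ => (((l : ℂ) - p) ^ a)⁻¹)
      (2 * if Even a then riemannZeta a else 0) (symmetricIcc ℤ) := by
  rcases ha.eq_or_lt with rfl | ha
  · simpa using hasSum_inv_intCast_sub p
  have hs : Summable fun l : ℤ => ((l : ℂ) ^ a)⁻¹ := by
    have := (Real.summable_one_div_int_pow (p := a)).2 ha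
    refine Summable.of_norm ?_
    refine this.abs.congr fun l => ?_
    simp
  have h0 : HasSum (fun l : ℤ => ((l : ℂ) ^ a)⁻¹) (2 * if Even a then riemannZeta a else 0) := by
    split_ifs with he
    · rw [two_mul_riemannZeta_eq_tsum_int_inv_pow_of_even ha he]
      exact hs.hasSum
    · have h := (Equiv.neg ℤ).tsum_eq fun l : ℤ => ((l : ℂ) ^ a)⁻¹
      have h' : ∑' l : ℤ, ((l : ℂ) ^ a)⁻¹ = 0 := by
        simp only [Equiv.neg_apply, Int.cast_neg, (Nat.not_even_iff_odd.mp he).neg_pow, inv_neg,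
          tsum_neg] at h
        exact neg_eq_self.mp h
      rw [mul_zero, ← h']
      exact hs.hasSum
  have h1 := (Equiv.subRight p).hasSum_iff.mpr h0
  simp only [Function.comp_def, Equiv.subRight_apply, Int.cast_sub] at h1
  exact h1.mono_left (LeAtTop.le_atTop)

/-! ### Sums of rational functions with three integer poles -/

/-- The even zeta values as a power series, `∑ ζ(2ξ) X ^ (2ξ)`. -/
noncomputable def evenZetaSeries : PowerSeries ℂ :=
  PowerSeries.mk fun j => if Even j then riemannZeta j else 0

/-- The expansion of `1 / (X + d)` at the origin (for `d ≠ 0`). -/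
noncomputable def invShift (d : ℂ) : PowerSeries ℂ := (PowerSeries.X + PowerSeries.C d)⁻¹

theorem shift_mul_invShift {d : ℂ} (hd : d ≠ 0) :
    (PowerSeries.X + PowerSeries.C d) * invShift d = 1 :=
  PowerSeries.mul_inv_cancel _ (by simpa using hd)

theorem constantCoeff_invShift (d : ℂ) : PowerSeries.constantCoeff (invShift d) = d⁻¹ := by
  simp [invShift, PowerSeries.constantCoeff_inv]

open PowerSeries in
/-- The sum over the three poles `p`, `q`, `r` of `1 / ((t - p) ^ a * (t - q) ^ b * (t - r) ^ c)`
of the coefficient of degree zero in its Laurent expansion times `evenZetaSeries`. The factor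
`(t - p) ^ (-a)` is encoded by reading off the coefficient of degree `a` of the remaining factors,
expanded at `p`; the same is done at `q` and `r`. -/
noncomputable def polarSum (p q r : ℤ) (a b c : ℕ) : ℂ :=
  coeff a (evenZetaSeries * invShift (p - q) ^ b * invShift (p - r) ^ c)
  + coeff b (evenZetaSeries * invShift (q - p) ^ a * invShift (q - r) ^ c)
  + coeff c (evenZetaSeries * invShift (r - p) ^ a * invShift (r - q) ^ b)

/-- The function `1 / ((l - p) ^ a * (l - q) ^ b * (l - r) ^ c)` on the integers, set to zero at
`p`, `q` and `r`. -/
noncomputable def threePole (p q r : ℤ) (a b c : ℕ) (l : ℤ) : ℂ :=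
  if l = p ∨ l = q ∨ l = r then 0
  else (((l : ℂ) - p) ^ a)⁻¹ * (((l : ℂ) - q) ^ b)⁻¹ * (((l : ℂ) - r) ^ c)⁻¹

theorem polarSum_rotate (p q r : ℤ) (a b c : ℕ) :
    polarSum q r p b c a = polarSum p q r a b c := by
  unfold polarSum
  rw [mul_right_comm _ (invShift (q - r) ^ c), mul_right_comm _ (invShift (r - q) ^ b)]
  ring

theorem threePole_rotate (p q r : ℤ) (a b c : ℕ) :
    threePole q r p b c a = threePole p q r a b c := by
  ext l
  have : (l = q ∨ l = r ∨ l = p) ↔ (l = p ∨ l = q ∨ l = r) := by tauto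
  simp only [threePole, this, mul_comm _ (((l : ℂ) - p) ^ a)⁻¹, mul_assoc]

/-- The recursion given by `p - q = (l - q) - (l - p)`. -/
theorem sub_mul_threePole (p q r : ℤ) (a b c : ℕ) (l : ℤ) :
    ((p : ℂ) - q) * threePole p q r (a + 1) (b + 1) c l
      = threePole p q r (a + 1) b c l - threePole p q r a (b + 1) c l := by
  unfold threePole
  split_ifs with h
  · simp
  · have h1 : (l : ℂ) - p ≠ 0 := sub_ne_zero.mpr (by exact_mod_cast fun e => h (.inl e))
    have h2 : (l : ℂ) - q ≠ 0 := sub_ne_zero.mpr (by exact_mod_cast fun e => h (.inr (.inl e)))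
    simp only [pow_succ]
    field_simp
    ring

/-- The Laurent coefficients satisfy the same recursion as the function they belong to. -/
theorem sub_mul_polarSum {p q r : ℤ} (hpq : p ≠ q) (hpr : p ≠ r) (hqr : q ≠ r) (a b c : ℕ) :
    ((p : ℂ) - q) * polarSum p q r (a + 1) (b + 1) c
      = polarSum p q r (a + 1) b c - polarSum p q r a (b + 1) c := by
  have ne : ∀ {x y : ℤ}, x ≠ y → (x : ℂ) - y ≠ 0 := fun h =>
    sub_ne_zero.mpr (by exact_mod_cast h)
  have e1 := shift_mul_invShift (ne hpq)
  have e2 := shift_mul_invShift (ne hpq.symm)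
  have e3 := shift_mul_invShift (ne hpr.symm)
  have e4 := shift_mul_invShift (ne hqr.symm)
  set Z := evenZetaSeries
  have k1 : PowerSeries.C ((p : ℂ) - q) * (Z * invShift (p - q) ^ (b + 1) * invShift (p - r) ^ c)
      = Z * invShift (p - q) ^ b * invShift (p - r) ^ c
        - PowerSeries.X * (Z * invShift (p - q) ^ (b + 1) * invShift (p - r) ^ c) := by
    linear_combination (Z * invShift (p - q) ^ b * invShift (p - r) ^ c) * e1
  have k2 : PowerSeries.C ((p : ℂ) - q) * (Z * invShift (q - p) ^ (a + 1) * invShift (q - r) ^ c)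
      = PowerSeries.X * (Z * invShift (q - p) ^ (a + 1) * invShift (q - r) ^ c)
        - Z * invShift (q - p) ^ a * invShift (q - r) ^ c := by
    simp only [map_sub] at e2 ⊢
    linear_combination (-(Z * invShift (q - p) ^ a * invShift (q - r) ^ c)) * e2
  have k3 : PowerSeries.C ((p : ℂ) - q)
        * (Z * invShift (r - p) ^ (a + 1) * invShift (r - q) ^ (b + 1))
      = Z * invShift (r - p) ^ (a + 1) * invShift (r - q) ^ b
        - Z * invShift (r - p) ^ a * invShift (r - q) ^ (b + 1) := by
    simp only [map_sub] at e3 e4 ⊢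
    linear_combination (Z * invShift (r - p) ^ (a + 1) * invShift (r - q) ^ b) * e4
      - (Z * invShift (r - p) ^ a * invShift (r - q) ^ (b + 1)) * e3
  simp only [polarSum, mul_add, ← PowerSeries.coeff_C_mul]
  rw [k1, k2, k3]
  simp only [map_sub, PowerSeries.coeff_succ_X_mul]
  ring

/-- The case of a single pole `p`. The excluded terms `l = q` and `l = r` are matched by the constant
Laurent coefficients at `q` and `r`, because `2 ζ(0) = -1`. -/
theorem hasSum_threePole_single {p q r : ℤ} (hpq : p ≠ q) (hpr : p ≠ r) (hqr : q ≠ r) {a : ℕ}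
    (ha : 1 ≤ a) :
    HasSum (threePole p q r a 0 0) (2 * polarSum p q r a 0 0) (symmetricIcc ℤ) := by
  have h := ((hasSum_inv_intCast_sub_pow p ha).sub
    (hasSum_ite_eq q ((((q : ℂ) - p) ^ a)⁻¹) (L := symmetricIcc ℤ))).sub
    (hasSum_ite_eq r ((((r : ℂ) - p) ^ a)⁻¹) (L := symmetricIcc ℤ))
  convert! h using 1
  · ext l
    unfold threePole
    by_cases h1 : l = p
    · subst h1
      have ha0 : a ≠ 0 := by omega
      simp [hpq, hpr, ha0]
    by_cases h2 : l = q
    · subst h2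
      simp [hqr]
    by_cases h3 : l = r
    · subst h3
      simp [h2]
    simp [h1, h2, h3]
  · have hz : PowerSeries.constantCoeff evenZetaSeries = -1 / 2 := by
      rw [← PowerSeries.coeff_zero_eq_constantCoeff_apply, evenZetaSeries, PowerSeries.coeff_mk]
      simp [riemannZeta_zero]
    simp only [polarSum, pow_zero, mul_one, PowerSeries.coeff_zero_eq_constantCoeff, map_mul,
      map_pow, constantCoeff_invShift, hz]
    rw [evenZetaSeries, PowerSeries.coeff_mk, inv_pow, inv_pow]
    ring

/-- The residue evaluation of a sum over the integers with three poles removed. -/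
theorem hasSum_threePole {p q r : ℤ} (hpq : p ≠ q) (hpr : p ≠ r) (hqr : q ≠ r) (a b c : ℕ)
    (h : a + b + c ≠ 0) :
    HasSum (threePole p q r a b c) (2 * polarSum p q r a b c) (symmetricIcc ℤ) := by
  obtain ⟨N, hN⟩ : ∃ N, N = a + b + c := ⟨_, rfl⟩
  induction N generalizing p q r a b c with
  | zero => omega
  | succ N ih =>
    -- the reduction of the exponents at the first two poles
    have step : ∀ {p q r : ℤ} {a b c : ℕ}, p ≠ q → p ≠ r → q ≠ r → 1 ≤ a → 1 ≤ b →
        N + 1 = a + b + c →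
        HasSum (threePole p q r a b c) (2 * polarSum p q r a b c) (symmetricIcc ℤ) := by
      intro p q r a b c hpq hpr hqr ha hb hN
      obtain ⟨a, rfl⟩ := Nat.exists_eq_add_of_le' ha
      obtain ⟨b, rfl⟩ := Nat.exists_eq_add_of_le' hb
      have hne : (p : ℂ) - q ≠ 0 := sub_ne_zero.mpr (by exact_mod_cast hpq)
      have := ((ih hpq hpr hqr (a + 1) b c (by omega) (by omega)).sub
        (ih hpq hpr hqr a (b + 1) c (by omega) (by omega))).mul_left ((p : ℂ) - q)⁻¹
      simp only [← mul_sub, ← sub_mul_threePole, ← sub_mul_polarSum hpq hpr hqr,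
        mul_left_comm (2 : ℂ), inv_mul_cancel_left₀ hne] at this
      exact this
    rcases Nat.eq_zero_or_pos a with rfl | ha
    · rcases Nat.eq_zero_or_pos b with rfl | hb
      · rw [← threePole_rotate, ← threePole_rotate, ← polarSum_rotate, ← polarSum_rotate]
        exact hasSum_threePole_single hpr.symm hqr.symm hpq (by omega)
      · rcases Nat.eq_zero_or_pos c with rfl | hc
        · rw [← threePole_rotate, ← polarSum_rotate]
          exact hasSum_threePole_single hqr hpq.symm hpr.symm (by omega)
        · rw [← threePole_rotate, ← polarSum_rotate]
          exact step hqr hpq.symm hpr.symm hb hc (by omega)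
    · rcases Nat.eq_zero_or_pos b with rfl | hb
      · rcases Nat.eq_zero_or_pos c with rfl | hc
        · exact hasSum_threePole_single hpq hpr hqr (by omega)
        · rw [← threePole_rotate, ← threePole_rotate, ← polarSum_rotate, ← polarSum_rotate]
          exact step hpr.symm hqr.symm hpq hc ha (by omega)
      · exact step hpq hpr hqr ha hb hN

/-! ### Power series coefficients and partial fractions -/

theorem coeff_invShift_pow {d : ℂ} (hd : d ≠ 0) (b j : ℕ) :
    PowerSeries.coeff j (invShift d ^ b)
      = (-1) ^ j * ((j + b - 1).choose j : ℂ) * d⁻¹ ^ (b + j) := by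
  induction b generalizing j with
  | zero =>
    rcases j with _ | j <;> simp [PowerSeries.coeff_one]
  | succ b ih =>
    have key : PowerSeries.C d * invShift d ^ (b + 1)
        = invShift d ^ b - PowerSeries.X * invShift d ^ (b + 1) := by
      linear_combination (invShift d ^ b) * shift_mul_invShift hd
    have hc : ∀ j, PowerSeries.coeff j (invShift d ^ (b + 1))
        = d⁻¹ * PowerSeries.coeff j (PowerSeries.C d * invShift d ^ (b + 1)) := fun j => by
      rw [PowerSeries.coeff_C_mul, inv_mul_cancel_left₀ hd]
    induction j with
    | zero =>
      rw [hc, key, map_sub, ih]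
      simp
      ring
    | succ j ihj =>
      rw [hc, key, map_sub, ih, PowerSeries.coeff_succ_X_mul, ihj]
      have e1 : j + 1 + b - 1 = j + b := by omega
      have e2 : j + (b + 1) - 1 = j + b := by omega
      have e3 : j + 1 + (b + 1) - 1 = j + b + 1 := by omega
      rw [e1, e2, e3, Nat.choose_succ_succ]
      push_cast
      ring

theorem coeff_invShift_pow_mul {d e : ℂ} (hd : d ≠ 0) (he : e ≠ 0) (b : ℕ) {c : ℕ} (hc : 1 ≤ c)
    (k : ℕ) :
    PowerSeries.coeff k (invShift d ^ b * invShift e ^ c)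
      = (-1) ^ k * ∑ ω ∈ Finset.range (k + 1), ((ω + b - 1).choose ω : ℂ)
          * ((k + c - ω - 1).choose (c - 1) : ℂ) * (d⁻¹ ^ (b + ω) * e⁻¹ ^ (k + c - ω)) := by
  rw [PowerSeries.coeff_mul, Finset.Nat.sum_antidiagonal_eq_sum_range_succ_mk, Finset.mul_sum]
  refine Finset.sum_congr rfl fun ω hω => ?_
  obtain ⟨j, rfl⟩ := Nat.exists_eq_add_of_le (Nat.le_of_lt_succ (Finset.mem_range.mp hω))
  have e1 : ω + j + c - ω = c + j := by omega
  have e2 : c + j - 1 = j + c - 1 := by omega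
  have e3 : (j + c - 1).choose (c - 1) = (j + c - 1).choose j := by
    rw [← Nat.choose_symm_of_eq_add]; omega
  simp only [coeff_invShift_pow hd, coeff_invShift_pow he, Nat.add_sub_cancel_left, e1, e2, e3]
  ring

/-- Partial fractions: if `u v = w (u + v)`, as for `u = 1 / x`, `v = 1 / y`, `w = 1 / (x + y)`,
then `u ^ a v ^ c` is a combination of monomials in `u`, `w` and of monomials in `v`, `w`. -/
theorem pow_mul_pow_eq_sum_add_sum {R : Type*} [CommRing R] {u v w : R} (h : u * v = w * (u + v))
    (a c : ℕ) :
    u ^ (a + 1) * v ^ (c + 1)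
      = ∑ ω ∈ Finset.range (a + 1), ((a + c - ω).choose c : R) * w ^ (a + c + 1 - ω) * u ^ (ω + 1)
        + ∑ ω ∈ Finset.range (c + 1),
            ((a + c - ω).choose a : R) * w ^ (a + c + 1 - ω) * v ^ (ω + 1) := by
  -- the first sum satisfies the recursion that `u v = w (u + v)` gives for the left-hand side
  have hrec : ∀ (u : R) (a c : ℕ), ∑ ω ∈ Finset.range (a + 2),
      ((a + 1 + (c + 1) - ω).choose (c + 1) : R) * w ^ (a + 1 + (c + 1) + 1 - ω) * u ^ (ω + 1)
      = w * ((∑ ω ∈ Finset.range (a + 2),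
          ((a + 1 + c - ω).choose c : R) * w ^ (a + 1 + c + 1 - ω) * u ^ (ω + 1))
        + ∑ ω ∈ Finset.range (a + 1),
          ((a + (c + 1) - ω).choose (c + 1) : R) * w ^ (a + (c + 1) + 1 - ω) * u ^ (ω + 1)) := by
    intro u a c
    rw [Finset.sum_range_succ, Finset.sum_range_succ _ (a + 1), add_right_comm (Finset.sum _ _),
      mul_add, ← Finset.sum_add_distrib, Finset.mul_sum]
    congr 1
    · refine Finset.sum_congr rfl fun ω hω => ?_
      obtain ⟨j, rfl⟩ := Nat.exists_eq_add_of_le (Nat.le_of_lt_succ (Finset.mem_range.mp hω))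
      have e1 : ω + j + 1 + (c + 1) - ω = j + c + 1 + 1 := by omega
      have e2 : ω + j + 1 + (c + 1) + 1 - ω = j + c + 3 := by omega
      have e3 : ω + j + 1 + c - ω = j + c + 1 := by omega
      have e4 : ω + j + 1 + c + 1 - ω = j + c + 2 := by omega
      have e5 : ω + j + (c + 1) - ω = j + c + 1 := by omega
      have e6 : ω + j + (c + 1) + 1 - ω = j + c + 2 := by omega
      rw [e1, e2, e3, e4, e5, e6, Nat.choose_succ_succ]
      push_cast
      ring
    · have e1 : a + 1 + (c + 1) - (a + 1) = c + 1 := by omega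
      have e2 : a + 1 + (c + 1) + 1 - (a + 1) = c + 2 := by omega
      have e3 : a + 1 + c - (a + 1) = c := by omega
      have e4 : a + 1 + c + 1 - (a + 1) = c + 1 := by omega
      rw [e1, e2, e3, e4, Nat.choose_self, Nat.choose_self]
      ring
  -- the case in which one exponent is `1`
  have base : ∀ (u v : R), u * v = w * (u + v) → ∀ a : ℕ, u ^ (a + 1) * v
      = ∑ ω ∈ Finset.range (a + 1), w ^ (a + 1 - ω) * u ^ (ω + 1) + w ^ (a + 1) * v := by
    intro u v h a
    induction a with
    | zero => simp; linear_combination h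
    | succ a ih =>
      rw [Finset.sum_range_succ]
      have : ∑ ω ∈ Finset.range (a + 1), w ^ (a + 1 + 1 - ω) * u ^ (ω + 1)
          = w * ∑ ω ∈ Finset.range (a + 1), w ^ (a + 1 - ω) * u ^ (ω + 1) := by
        rw [Finset.mul_sum]
        refine Finset.sum_congr rfl fun ω hω => ?_
        rw [Nat.sub_add_comm (Finset.mem_range.mp hω).le]
        ring
      rw [this, Nat.add_sub_cancel_left]
      linear_combination w * ih + u ^ (a + 1) * h
  induction a generalizing c with
  | zero =>
    have := base v u (by linear_combination h) c
    simp only [zero_add, Finset.sum_range_one, Nat.sub_zero, Nat.choose_self, Nat.choose_zero_right,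
      Nat.cast_one, one_mul, pow_one]
    linear_combination this
  | succ a iha =>
    induction c with
    | zero =>
      simpa using base u v h (a + 1)
    | succ c ihc =>
      have r1 := hrec u a c
      have r2 := hrec v c a
      have i1 := iha (c + 1)
      rw [show c + 1 + (a + 1) = a + 1 + (c + 1) by omega, show c + 1 + a = a + (c + 1) by omega,
        show c + (a + 1) = a + 1 + c by omega] at r2
      rw [r1, r2]
      linear_combination w * ihc + w * i1 + u ^ (a + 1) * v ^ (c + 1) * h

/-! ### The residues for fixed `m` and `n` -/

theorem coeff_evenZetaSeries_mul (G : PowerSeries ℂ) (a : ℕ) :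
    PowerSeries.coeff a (evenZetaSeries * G)
      = ∑ ξ ∈ Finset.range (a / 2 + 1),
          riemannZeta ((2 * ξ : ℕ) : ℂ) * PowerSeries.coeff (a - 2 * ξ) G := by
  rw [PowerSeries.coeff_mul, Finset.Nat.sum_antidiagonal_eq_sum_range_succ_mk]
  simp only [evenZetaSeries, PowerSeries.coeff_mk, ite_mul, zero_mul]
  rw [← Finset.sum_filter]
  symm
  refine Finset.sum_nbij (fun ξ => 2 * ξ) ?_ ?_ ?_ ?_
  · intro ξ hξ
    simp only [Finset.mem_range, Finset.mem_filter] at hξ ⊢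
    exact ⟨by omega, even_two_mul ξ⟩
  · intro x _ y _ h
    simpa using h
  · intro j hj
    simp only [Finset.coe_filter, Finset.mem_range, Set.mem_ofPred_eq] at hj
    obtain ⟨h1, k, rfl⟩ := hj
    exact ⟨k, by simp; omega, by simp; omega⟩
  · intro ξ _
    rfl

/-- The sum that the residues at the two extreme poles produce, with `D s t` in place of
`1 / (x ^ s * y ^ t)`. -/
noncomputable def endpointPart (a b c : ℕ) (D : ℕ → ℕ → ℂ) : ℂ :=
  ∑ ξ ∈ Finset.range (a / 2 + 1), riemannZeta ((2 * ξ : ℕ) : ℂ) *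
    ∑ ω ∈ Finset.range (a - 2 * ξ + 1),
      (Nat.choose (ω + b - 1) ω : ℂ) * (Nat.choose (a + c - 2 * ξ - ω - 1) (c - 1) : ℂ) *
        D (b + ω) (a + c - 2 * ξ - ω)

/-- The sum that the residue at the middle pole produces after partial fractions, with `D s t`
in place of `1 / (x ^ s * y ^ t)`. -/
noncomputable def midpointPart (a b c : ℕ) (D : ℕ → ℕ → ℂ) : ℂ :=
  ∑ ξ ∈ Finset.range (b / 2 + 1), riemannZeta ((2 * ξ : ℕ) : ℂ) *
    ∑ ω ∈ Finset.range (a - 1 + 1),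
      (Nat.choose (ω + b - 2 * ξ) ω : ℂ) * (Nat.choose (a + c - ω - 2) (c - 1) : ℂ) *
        D (b - 2 * ξ + ω + 1) (a + c - 1 - ω)

/-- The summand of the double zeta value with exponents `s`, `t`. -/
noncomputable def doubleTerm (x y : ℂ) (s t : ℕ) : ℂ := 1 / (x ^ s * y ^ t)

theorem coeff_evenZetaSeries_mul_invShift {d e : ℂ} (hd : d ≠ 0) (he : e ≠ 0) (a b : ℕ) {c : ℕ}
    (hc : 1 ≤ c) :
    PowerSeries.coeff a (evenZetaSeries * invShift d ^ b * invShift e ^ c)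
      = (-1) ^ a * endpointPart a b c (doubleTerm d e) := by
  rw [mul_assoc, coeff_evenZetaSeries_mul, endpointPart, Finset.mul_sum]
  refine Finset.sum_congr rfl fun ξ hξ => ?_
  obtain ⟨k, rfl⟩ := Nat.exists_eq_add_of_le (show 2 * ξ ≤ a by
    have := Finset.mem_range.mp hξ; omega)
  have e1 : 2 * ξ + k - 2 * ξ = k := by omega
  have e2 : 2 * ξ + k + c - 2 * ξ = k + c := by omega
  rw [e1, e2, coeff_invShift_pow_mul hd he _ hc, pow_add, Even.neg_one_pow (even_two_mul ξ)]
  simp only [doubleTerm, one_div, mul_inv, inv_pow]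
  ring

/-- All the monomials in `endpointPart` have total degree `≡ a + b + c` modulo two. -/
theorem endpointPart_neg (d e : ℂ) (a b c : ℕ) :
    endpointPart a b c (doubleTerm (-d) (-e))
      = (-1) ^ (a + b + c) * endpointPart a b c (doubleTerm d e) := by
  rw [endpointPart, endpointPart, Finset.mul_sum]
  refine Finset.sum_congr rfl fun ξ hξ => ?_
  rw [mul_left_comm, Finset.mul_sum (a := (-1 : ℂ) ^ (a + b + c))]
  refine congrArg _ (Finset.sum_congr rfl fun ω hω => ?_)
  rw [mul_left_comm]
  refine congrArg _ ?_
  have e1 : a + b + c = 2 * ξ + ((b + ω) + (a + c - 2 * ξ - ω)) := by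
    have := Finset.mem_range.mp hω
    have := Finset.mem_range.mp hξ
    omega
  rw [doubleTerm, doubleTerm, neg_pow d, neg_pow e, e1, pow_add _ (2 * ξ),
    Even.neg_one_pow (even_two_mul ξ), pow_add _ (b + ω), one_div, one_div, mul_mul_mul_comm,
    mul_inv, mul_inv ((-1 : ℂ) ^ _), ← inv_pow, ← inv_pow, inv_neg_one, one_mul]

/-- The coefficient at the middle pole: `1 / ((X + d) ^ a * (e - X) ^ c)` is decomposed into partial
fractions with respect to `(X + d) + (e - X) = d + e` before it is expanded. -/
theorem coeff_evenZetaSeries_mul_invShift_neg {d e : ℂ} (hd : d ≠ 0) (he : e ≠ 0)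
    (hde : d + e ≠ 0) (b : ℕ) {a c : ℕ} (ha : 1 ≤ a) (hc : 1 ≤ c) :
    (-1) ^ c * PowerSeries.coeff b (evenZetaSeries * invShift d ^ a * invShift (-e) ^ c)
      = (-1) ^ b * midpointPart a b c (doubleTerm d (d + e))
        + midpointPart c b a (doubleTerm e (d + e)) := by
  obtain ⟨a, rfl⟩ := Nat.exists_eq_add_of_le' ha
  obtain ⟨c, rfl⟩ := Nat.exists_eq_add_of_le' hc
  have h : invShift d * (-invShift (-e))
      = PowerSeries.C (d + e)⁻¹ * (invShift d + (-invShift (-e))) := by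
    have h1 := shift_mul_invShift hd
    have h2 := shift_mul_invShift (neg_ne_zero.mpr he)
    have h3 : PowerSeries.C (d + e)⁻¹ * (PowerSeries.C d + PowerSeries.C e) = 1 := by
      rw [← map_add, ← map_mul, inv_mul_cancel₀ hde, map_one]
    rw [map_neg] at h2
    linear_combination (PowerSeries.C (d + e)⁻¹ * invShift d) * h2
      - (PowerSeries.C (d + e)⁻¹ * invShift (-e)) * h1 + invShift d * invShift (-e) * h3
  have hpf := pow_mul_pow_eq_sum_add_sum h a c
  rw [neg_pow, mul_left_comm] at hpf
  rw [mul_assoc, coeff_evenZetaSeries_mul, midpointPart, midpointPart, Finset.mul_sum,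
    Finset.mul_sum, ← Finset.sum_add_distrib]
  refine Finset.sum_congr rfl fun ξ hξ => ?_
  obtain ⟨k, rfl⟩ := Nat.exists_eq_add_of_le (show 2 * ξ ≤ b by
    have := Finset.mem_range.mp hξ; omega)
  have hC : (-1 : PowerSeries ℂ) ^ (c + 1) = PowerSeries.C ((-1) ^ (c + 1)) := by simp
  have hcoef := congrArg (PowerSeries.coeff k) hpf
  rw [hC, PowerSeries.coeff_C_mul] at hcoef
  have e1 : 2 * ξ + k - 2 * ξ = k := by omega
  rw [e1, mul_left_comm, hcoef, map_add, map_sum, map_sum, pow_add,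
    Even.neg_one_pow (even_two_mul ξ), mul_add, one_mul, mul_left_comm ((-1 : ℂ) ^ k)]
  congr 2
  · rw [Finset.mul_sum]
    refine Finset.sum_congr (by simp) fun ω hω => ?_
    have e2 : ω + (2 * ξ + k) - 2 * ξ = k + (ω + 1) - 1 := by omega
    have e3 : a + 1 + (c + 1) - ω - 2 = a + c - ω := by omega
    have e4 : a + 1 + (c + 1) - 1 - ω = a + c + 1 - ω := by omega
    have e5 : (k + (ω + 1) - 1).choose ω = (k + (ω + 1) - 1).choose k := by
      rw [← Nat.choose_symm_of_eq_add]; omega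
    rw [← map_pow, ← map_natCast (PowerSeries.C (R := ℂ)), ← map_mul, PowerSeries.coeff_C_mul,
      coeff_invShift_pow hd, e2, e3, e4, e5, Nat.add_sub_cancel, doubleTerm, one_div, mul_inv,
      inv_pow, inv_pow]
    ring
  · refine Finset.sum_congr (by simp) fun ω hω => ?_
    have e2 : ω + (2 * ξ + k) - 2 * ξ = k + (ω + 1) - 1 := by omega
    have e3 : c + 1 + (a + 1) - ω - 2 = a + c - ω := by omega
    have e4 : c + 1 + (a + 1) - 1 - ω = a + c + 1 - ω := by omega
    have e5 : (k + (ω + 1) - 1).choose ω = (k + (ω + 1) - 1).choose k := by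
      rw [← Nat.choose_symm_of_eq_add]; omega
    have hC : (-1 : PowerSeries ℂ) ^ (ω + 1) = PowerSeries.C ((-1) ^ (ω + 1)) := by simp
    rw [← map_pow, ← map_natCast (PowerSeries.C (R := ℂ)), ← map_mul, PowerSeries.coeff_C_mul,
      neg_pow, hC, PowerSeries.coeff_C_mul,
      coeff_invShift_pow (neg_ne_zero.mpr he), e2, e3, e4, e5, Nat.add_sub_cancel, doubleTerm,
      one_div, mul_inv, inv_pow, inv_neg, neg_pow e⁻¹, inv_pow]
    have hs : (-1 : ℂ) ^ (ω + 1) * ((-1) ^ k * (-1) ^ (ω + 1 + k)) = 1 := by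
      rw [← pow_add, ← pow_add]
      exact Even.neg_one_pow ⟨ω + 1 + k, by ring⟩
    linear_combination ((a + c - ω).choose a * ((d + e) ^ (a + c + 1 - ω))⁻¹
      * (k + (ω + 1) - 1).choose k * (e ^ (ω + 1 + k))⁻¹ : ℂ) * hs

/-- The sign passes from `1 / (t ^ a * (t - m) ^ b * (t - n) ^ c)` to
`1 / (t ^ a * (m - t) ^ b * (n - t) ^ c)`. -/
theorem neg_one_pow_mul_polarSum {m n : ℕ} (hm : 0 < m) (hmn : m < n) {a b c : ℕ} (ha : 1 ≤ a)
    (hc : 1 ≤ c) :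
    (-1) ^ (b + c) * polarSum 0 m n a b c
      = endpointPart a b c (doubleTerm m n) + midpointPart a b c (doubleTerm m n)
        + (-1) ^ b * endpointPart c b a (doubleTerm ((n - m : ℕ) : ℂ) n)
        + (-1) ^ b * midpointPart c b a (doubleTerm ((n - m : ℕ) : ℂ) n) := by
  obtain ⟨k, rfl⟩ := Nat.exists_eq_add_of_le hmn.le
  have hm0 : (m : ℂ) ≠ 0 := Nat.cast_ne_zero.mpr hm.ne'
  have hk0 : (k : ℂ) ≠ 0 := Nat.cast_ne_zero.mpr (by omega)
  have hn0 : (m : ℂ) + k ≠ 0 := by exact_mod_cast (by omega : m + k ≠ 0)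
  have e1 : ((0 : ℤ) : ℂ) - ((m : ℤ) : ℂ) = -(m : ℂ) := by simp
  have e2 : ((0 : ℤ) : ℂ) - (((m + k : ℕ) : ℤ) : ℂ) = -((m : ℂ) + k) := by push_cast; ring
  have e3 : ((m : ℤ) : ℂ) - ((0 : ℤ) : ℂ) = m := by simp
  have e4 : ((m : ℤ) : ℂ) - (((m + k : ℕ) : ℤ) : ℂ) = -(k : ℂ) := by push_cast; ring
  have e5 : (((m + k : ℕ) : ℤ) : ℂ) - ((0 : ℤ) : ℂ) = (m : ℂ) + k := by push_cast; ring
  have e6 : (((m + k : ℕ) : ℤ) : ℂ) - ((m : ℤ) : ℂ) = k := by push_cast; ring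
  rw [polarSum, e1, e2, e3, e4, e5, e6, mul_right_comm _ (invShift ((m : ℂ) + k) ^ a),
    coeff_evenZetaSeries_mul_invShift (neg_ne_zero.mpr hm0) (neg_ne_zero.mpr hn0) _ _ hc,
    coeff_evenZetaSeries_mul_invShift hk0 hn0 _ _ ha, endpointPart_neg, Nat.add_sub_cancel_left,
    Nat.cast_add]
  have hmid := coeff_evenZetaSeries_mul_invShift_neg hm0 hk0 hn0 b ha hc
  have sq : ∀ j : ℕ, (-1 : ℂ) ^ j * (-1) ^ j = 1 := fun j => by
    rw [← pow_add, Even.neg_one_pow ⟨j, rfl⟩]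
  rw [pow_add (-1 : ℂ) b c, pow_add _ (a + b), pow_add _ a b]
  linear_combination (-1) ^ b * hmid
    + endpointPart a b c (doubleTerm m (m + k)) * ((-1) ^ (b + b + c + c) * sq a
      + (-1) ^ (c + c) * sq b + sq c)
    + midpointPart a b c (doubleTerm m (m + k)) * sq b
    + (-1) ^ b * endpointPart c b a (doubleTerm k (m + k)) * sq c

/-! ### Summation over the pairs `m < n` -/

theorem hasSum_endpointPart {ι : Type*} {D : ι → ℕ → ℕ → ℂ} {Z : ℕ → ℕ → ℂ}
    (h : ∀ s t, 1 ≤ s → 2 ≤ t → HasSum (fun i => D i s t) (Z s t)) (a : ℕ) {b c : ℕ}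
    (hb : 1 ≤ b) (hc : 2 ≤ c) :
    HasSum (fun i => endpointPart a b c (D i)) (endpointPart a b c Z) := by
  refine hasSum_sum fun ξ hξ => (hasSum_sum fun ω hω => ?_).mul_left _
  rw [Finset.mem_range] at hξ hω
  exact (h _ _ (by omega) (by omega)).mul_left _

theorem hasSum_midpointPart {ι : Type*} {D : ι → ℕ → ℕ → ℂ} {Z : ℕ → ℕ → ℂ}
    (h : ∀ s t, 1 ≤ s → 2 ≤ t → HasSum (fun i => D i s t) (Z s t)) {a : ℕ} (b : ℕ) {c : ℕ}
    (ha : 1 ≤ a) (hc : 2 ≤ c) :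
    HasSum (fun i => midpointPart a b c (D i)) (midpointPart a b c Z) := by
  refine hasSum_sum fun ξ hξ => (hasSum_sum fun ω hω => ?_).mul_left _
  rw [Finset.mem_range] at hξ hω
  exact (h _ _ (by omega) (by omega)).mul_left _

/-- The pairs `0 < m < n`. -/
abbrev OrderedPair : Type := {p : ℕ × ℕ // 0 < p.1 ∧ p.1 < p.2}

/-- The triples `0 < l < m < n`. -/
abbrev OrderedTriple : Type := {p : ℕ × ℕ × ℕ // 0 < p.1 ∧ p.1 < p.2.1 ∧ p.2.1 < p.2.2}

/-- The triples `(x, y, z)` with `0 < x` and `0 < y < z`. -/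
abbrev StuffleTriple : Type := {q : ℕ × ℕ × ℕ // 0 < q.1 ∧ 0 < q.2.1 ∧ q.2.1 < q.2.2}

theorem hasSum_doubleTerm {s t : ℕ} (hs : 1 ≤ s) (ht : 2 ≤ t) :
    HasSum (fun p : OrderedPair => doubleTerm p.1.1 p.1.2 s t) (doubleZeta s t) :=
  (summable_doubleZeta hs ht).hasSum

theorem hasSum_tripleZeta {a b c : ℕ} (ha : 2 ≤ a) (hb : 2 ≤ b) (hc : 2 ≤ c) :
    HasSum (fun p : OrderedTriple =>
      1 / ((p.1.1 : ℂ) ^ a * (p.1.2.1 : ℂ) ^ b * (p.1.2.2 : ℂ) ^ c)) (tripleZeta a b c) :=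
  (summable_tripleZeta ha hb hc).hasSum

/-- The reflection `(m, n) ↦ (n - m, n)`. -/
def OrderedPair.reflect : OrderedPair ≃ OrderedPair where
  toFun p := ⟨(p.1.2 - p.1.1, p.1.2), by have := p.2; simp only; omega⟩
  invFun p := ⟨(p.1.2 - p.1.1, p.1.2), by have := p.2; simp only; omega⟩
  left_inv p := by
    have := p.2
    ext <;> simp only
    omega
  right_inv p := by
    have := p.2
    ext <;> simp only
    omega

theorem hasSum_doubleTerm_reflect {s t : ℕ} (hs : 1 ≤ s) (ht : 2 ≤ t) :
    HasSum (fun p : OrderedPair => doubleTerm ((p.1.2 - p.1.1 : ℕ) : ℂ) p.1.2 s t)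
      (doubleZeta s t) :=
  OrderedPair.reflect.hasSum_iff.mpr (hasSum_doubleTerm hs ht)

/-- A sum over a region `S` can be computed after a bijective parametrization `i` of `S`. -/
theorem hasSum_ite_of_parametrization {ι κ : Type*} {F : κ → ℂ} {G : ι → ℂ} {s : ℂ}
    (h : HasSum G s) {S : κ → Prop} [DecidablePred S] (i : ι → κ) (hi : Function.Injective i)
    (hS : ∀ y, S (i y)) (hr : ∀ x, S x → ∃ y, i y = x) (hG : ∀ y, F (i y) = G y) :
    HasSum (fun x => if S x then F x else 0) s := by
  refine (hi.hasSum_iff fun x hx => if_neg fun hSx => hx (hr x hSx)).mp ?_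
  have e : (fun x => if S x then F x else 0) ∘ i = G := by
    ext y
    simp [hS, hG]
  rwa [e]

/-- The stuffle decomposition of `ζ(a) ζ₂(b, c)`, by the position of `x` relative to `y < z`. -/
theorem hasSum_stuffle {a b c : ℕ} (ha : 2 ≤ a) (hb : 2 ≤ b) (hc : 2 ≤ c) :
    HasSum (fun q : StuffleTriple =>
        1 / ((q.1.1 : ℂ) ^ a * (q.1.2.1 : ℂ) ^ b * (q.1.2.2 : ℂ) ^ c))
      (tripleZeta a b c + doubleZeta (a + b) c + tripleZeta b a c + doubleZeta b (a + c)
        + tripleZeta b c a) := by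
  set F := fun q : StuffleTriple =>
        1 / ((q.1.1 : ℂ) ^ a * (q.1.2.1 : ℂ) ^ b * (q.1.2.2 : ℂ) ^ c) with hF
  have h1 := hasSum_ite_of_parametrization (F := F) (hasSum_tripleZeta ha hb hc)
    (S := fun q => q.1.1 < q.1.2.1)
    (fun p => ⟨p.1, p.2.1, by have := p.2; omega, p.2.2.2⟩)
    (by rintro ⟨⟨_, _, _⟩, _⟩ ⟨⟨_, _, _⟩, _⟩ h; simpa using h)
    (fun p => p.2.2.1)
    (fun q hq => ⟨⟨q.1, q.2.1, hq, q.2.2.2⟩, rfl⟩)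
    (fun p => rfl)
  have h2 := hasSum_ite_of_parametrization (F := F)
    (hasSum_doubleTerm (s := a + b) (t := c) (by omega) hc)
    (S := fun q => q.1.1 = q.1.2.1)
    (fun p => ⟨(p.1.1, p.1.1, p.1.2), p.2.1, p.2.1, p.2.2⟩)
    (by rintro ⟨⟨_, _⟩, _⟩ ⟨⟨_, _⟩, _⟩ h; simpa using h)
    (fun p => rfl)
    (by
      rintro ⟨⟨x, y, z⟩, h⟩ hq
      simp only at h hq
      subst hq
      exact ⟨⟨(x, z), h.2⟩, rfl⟩)
    (fun p => by simp only [hF, doubleTerm, pow_add])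
  have h3 := hasSum_ite_of_parametrization (F := F) (hasSum_tripleZeta hb ha hc)
    (S := fun q => q.1.2.1 < q.1.1 ∧ q.1.1 < q.1.2.2)
    (fun p => ⟨(p.1.2.1, p.1.1, p.1.2.2), by have := p.2; simp only; omega⟩)
    (by rintro ⟨⟨_, _, _⟩, _⟩ ⟨⟨_, _, _⟩, _⟩ h; simp at h ⊢; omega)
    (fun p => p.2.2)
    (fun q hq => ⟨⟨(q.1.2.1, q.1.1, q.1.2.2), q.2.2.1, hq⟩, rfl⟩)
    (fun p => by simp only [hF]; ring)
  have h4 := hasSum_ite_of_parametrization (F := F)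
    (hasSum_doubleTerm (s := b) (t := a + c) (by omega) (by omega))
    (S := fun q => q.1.1 = q.1.2.2)
    (fun p => ⟨(p.1.2, p.1.1, p.1.2), by have := p.2; simp only; omega⟩)
    (by rintro ⟨⟨_, _⟩, _⟩ ⟨⟨_, _⟩, _⟩ h; simp at h ⊢; omega)
    (fun p => rfl)
    (by
      rintro ⟨⟨x, y, z⟩, h⟩ hq
      simp only at h hq
      subst hq
      exact ⟨⟨(y, x), h.2⟩, rfl⟩)
    (fun p => by simp only [hF, doubleTerm]; ring)
  have h5 := hasSum_ite_of_parametrization (F := F) (hasSum_tripleZeta hb hc ha)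
    (S := fun q => q.1.2.2 < q.1.1)
    (fun p => ⟨(p.1.2.2, p.1.1, p.1.2.1), by have := p.2; simp only; omega⟩)
    (by rintro ⟨⟨_, _, _⟩, _⟩ ⟨⟨_, _, _⟩, _⟩ h; simp at h ⊢; omega)
    (fun p => p.2.2.2)
    (fun q hq => ⟨⟨(q.1.2.1, q.1.2.2, q.1.1), q.2.2.1, q.2.2.2, hq⟩, rfl⟩)
    (fun p => by simp only [hF]; ring)
  have h := (((h1.add h2).add h3).add h4).add h5
  clear_value F
  convert h using 2 with q
  have := q.2
  split_ifs <;> first | omega | simp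

/-- The sum of `1 / (l ^ a * (m - l) ^ b * (n - l) ^ c)` over `0 < m < n` and all integers
`l ≠ 0, m, n`. On each of the regions cut out by `0 < m < n` the numbers `|l|`, `|m - l|`, `|n - l|`
are the new summation variables. -/
theorem hasSum_threePole_pairs {a b c : ℕ} (ha : 2 ≤ a) (hb : 2 ≤ b) (hc : 2 ≤ c) :
    HasSum (fun x : OrderedPair × ℤ =>
        (-1) ^ (b + c) * threePole 0 (x.1.1.1 : ℤ) (x.1.1.2 : ℤ) a b c x.2)
      ((-1) ^ a * tripleZeta a b c
        + (tripleZeta a b c + doubleZeta (a + b) c + tripleZeta b a c + doubleZeta b (a + c)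
          + tripleZeta b c a)
        + (-1) ^ b * (tripleZeta c b a + doubleZeta (c + b) a + tripleZeta b c a
          + doubleZeta b (c + a) + tripleZeta b a c)
        + (-1) ^ (b + c) * tripleZeta c b a) := by
  set F := fun x : OrderedPair × ℤ =>
    (-1 : ℂ) ^ (b + c) * threePole 0 (x.1.1.1 : ℤ) (x.1.1.2 : ℤ) a b c x.2 with hF
  have sq : ∀ j : ℕ, (-1 : ℂ) ^ j * (-1) ^ j = 1 := fun j => by
    rw [← pow_add, Even.neg_one_pow ⟨j, rfl⟩]
  have hval : ∀ (x : OrderedPair × ℤ) (u v w : ℂ), x.2 ≠ 0 → x.2 ≠ x.1.1.1 → x.2 ≠ x.1.1.2 →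
      (x.2 : ℂ) = u → (x.1.1.1 : ℂ) - x.2 = v → (x.1.1.2 : ℂ) - x.2 = w →
      F x = 1 / (u ^ a * v ^ b * w ^ c) := by
    rintro x _ _ _ h1 h2 h3 rfl rfl rfl
    simp only [hF, threePole, h1, h2, h3, or_self, if_false, Int.cast_zero, sub_zero,
      Int.cast_natCast]
    rw [← neg_sub (x.1.1.1 : ℂ), ← neg_sub (x.1.1.2 : ℂ), neg_pow ((x.1.1.1 : ℂ) - _),
      neg_pow ((x.1.1.2 : ℂ) - _), one_div, mul_inv, mul_inv, mul_inv, mul_inv, ← inv_pow (-1 : ℂ),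
      ← inv_pow (-1 : ℂ), inv_neg_one, pow_add]
    linear_combination (((x.2 : ℂ) ^ a)⁻¹ * (((x.1.1.1 : ℂ) - x.2) ^ b)⁻¹
      * (((x.1.1.2 : ℂ) - x.2) ^ c)⁻¹) * ((-1) ^ (c + c) * sq b + sq c)
  have inv_neg_pow : ∀ (x : ℂ) (k : ℕ), ((-x) ^ k)⁻¹ = (-1) ^ k * (x ^ k)⁻¹ := fun x k => by
    rw [neg_pow, mul_inv, ← inv_pow (-1 : ℂ), inv_neg_one]
  -- `l < 0`
  have h1 := hasSum_ite_of_parametrization (F := F)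
    ((hasSum_tripleZeta ha hb hc).mul_left ((-1) ^ a))
    (S := fun x => x.2 < 0)
    (fun p => (⟨(p.1.2.1 - p.1.1, p.1.2.2 - p.1.1), by have := p.2; simp only; omega⟩,
      -(p.1.1 : ℤ)))
    (by
      rintro ⟨⟨x, y, z⟩, h⟩ ⟨⟨x', y', z'⟩, h'⟩ e
      simp at e h h' ⊢
      omega)
    (fun p => by have := p.2; simp only; omega)
    (by
      rintro ⟨⟨⟨m, n⟩, h⟩, l⟩ hl
      simp only at hl h
      refine ⟨⟨(l.natAbs, l.natAbs + m, l.natAbs + n), by simp only; omega⟩, ?_⟩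
      ext <;> simp only <;> omega)
    (by
      rintro ⟨⟨x, y, z⟩, h⟩
      simp only at h
      rw [hval _ (-x) y z (by simp only; omega) (by simp only; omega) (by simp only; omega)
        (by simp) (by simp only [Nat.cast_sub h.2.1.le]; push_cast; ring)
        (by simp only [Nat.cast_sub (h.2.1.trans h.2.2).le]; push_cast; ring)]
      simp only [one_div, mul_inv, inv_neg_pow]
      ring)
  -- `0 < l < m`
  have h2 := hasSum_ite_of_parametrization (F := F) (hasSum_stuffle ha hb hc)
    (S := fun x => 0 < x.2 ∧ x.2 < x.1.1.1)
    (fun q => (⟨(q.1.1 + q.1.2.1, q.1.1 + q.1.2.2), by have := q.2; simp only; omega⟩, (q.1.1 : ℤ)))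
    (by
      rintro ⟨⟨x, y, z⟩, h⟩ ⟨⟨x', y', z'⟩, h'⟩ e
      simp at e h h' ⊢
      omega)
    (fun p => by have := p.2; simp only; omega)
    (by
      rintro ⟨⟨⟨m, n⟩, h⟩, l⟩ hl
      simp only at hl h
      refine ⟨⟨(l.natAbs, m - l.natAbs, n - l.natAbs), by simp only; omega⟩, ?_⟩
      ext <;> simp only <;> omega)
    (by
      rintro ⟨⟨x, y, z⟩, h⟩
      simp only at h
      rw [hval _ x y z (by simp only; omega) (by simp only; omega) (by simp only; omega)
        (by simp) (by push_cast; ring) (by push_cast; ring)])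
  -- `m < l < n`
  have h3 := hasSum_ite_of_parametrization (F := F) ((hasSum_stuffle hc hb ha).mul_left ((-1) ^ b))
    (S := fun x => x.1.1.1 < x.2 ∧ x.2 < x.1.1.2)
    (fun q => (⟨(q.1.2.2 - q.1.2.1, q.1.2.2 + q.1.1), by have := q.2; simp only; omega⟩,
      (q.1.2.2 : ℤ)))
    (by
      rintro ⟨⟨x, y, z⟩, h⟩ ⟨⟨x', y', z'⟩, h'⟩ e
      simp at e h h' ⊢
      omega)
    (fun p => by have := p.2; simp only; omega)
    (by
      rintro ⟨⟨⟨m, n⟩, h⟩, l⟩ hl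
      simp only at hl h
      refine ⟨⟨(n - l.natAbs, l.natAbs - m, l.natAbs), by simp only; omega⟩, ?_⟩
      ext <;> simp only <;> omega)
    (by
      rintro ⟨⟨z, y, x⟩, h⟩
      simp only at h
      rw [hval _ x (-y) z (by simp only; omega) (by simp only; omega) (by simp only; omega)
        (by simp) (by simp only [Nat.cast_sub h.2.2.le]; push_cast; ring) (by push_cast; ring)]
      simp only [one_div, mul_inv, inv_neg_pow]
      ring)
  -- `n < l`
  have h4 := hasSum_ite_of_parametrization (F := F)
    ((hasSum_tripleZeta hc hb ha).mul_left ((-1) ^ (b + c)))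
    (S := fun x => x.1.1.2 < x.2)
    (fun p => (⟨(p.1.2.2 - p.1.2.1, p.1.2.2 - p.1.1), by have := p.2; simp only; omega⟩,
      (p.1.2.2 : ℤ)))
    (by
      rintro ⟨⟨x, y, z⟩, h⟩ ⟨⟨x', y', z'⟩, h'⟩ e
      simp at e h h' ⊢
      omega)
    (fun p => by have := p.2; simp only; omega)
    (by
      rintro ⟨⟨⟨m, n⟩, h⟩, l⟩ hl
      simp only at hl h
      refine ⟨⟨(l.natAbs - n, l.natAbs - m, l.natAbs), by simp only; omega⟩, ?_⟩
      ext <;> simp only <;> omega)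
    (by
      rintro ⟨⟨z, y, x⟩, h⟩
      simp only at h
      rw [hval _ x (-y) (-z) (by simp only; omega) (by simp only; omega) (by simp only; omega)
        (by simp) (by simp only [Nat.cast_sub h.2.2.le]; push_cast; ring)
        (by simp only [Nat.cast_sub (h.2.1.trans h.2.2).le]; push_cast; ring)]
      simp only [one_div, mul_inv, inv_neg_pow]
      ring)
  have h := ((h1.add h2).add h3).add h4
  have h0 : ∀ x : OrderedPair × ℤ, x.2 = 0 ∨ x.2 = x.1.1.1 ∨ x.2 = x.1.1.2 → F x = 0 := by
    intro x hx
    simp only [hF, threePole, if_pos hx, mul_zero]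
  clear_value F
  convert h using 2 with x
  have := x.1.2
  split_ifs <;> first | omega | simp
  exact h0 x (by omega)

theorem mainTheorem9 (a b c : ℕ) (ha : 2 ≤ a) (hb : 2 ≤ b) (hc : 2 ≤ c) :
    (1 + (-1 : ℂ) ^ a) * tripleZeta a b c
      + (1 + (-1 : ℂ) ^ b) * (tripleZeta b a c + tripleZeta b c a)
      + (-1 : ℂ) ^ b * (1 + (-1 : ℂ) ^ c) * tripleZeta c b a
    = 2 * (
        (∑ ξ ∈ Finset.range (a / 2 + 1), riemannZeta ((2 * ξ : ℕ) : ℂ) *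
          ∑ ω ∈ Finset.range (a - 2 * ξ + 1),
            (Nat.choose (ω + b - 1) ω : ℂ) * (Nat.choose (a + c - 2 * ξ - ω - 1) (c - 1) : ℂ) *
              doubleZeta (b + ω) (a + c - 2 * ξ - ω))
        + (∑ ξ ∈ Finset.range (b / 2 + 1), riemannZeta ((2 * ξ : ℕ) : ℂ) *
          ∑ ω ∈ Finset.range (a - 1 + 1),
            (Nat.choose (ω + b - 2 * ξ) ω : ℂ) * (Nat.choose (a + c - ω - 2) (c - 1) : ℂ) *
              doubleZeta (b - 2 * ξ + ω + 1) (a + c - 1 - ω))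
        + (-1 : ℂ) ^ b * (∑ ξ ∈ Finset.range (c / 2 + 1), riemannZeta ((2 * ξ : ℕ) : ℂ) *
          ∑ ω ∈ Finset.range (c - 2 * ξ + 1),
            (Nat.choose (ω + b - 1) ω : ℂ) * (Nat.choose (a + c - 2 * ξ - ω - 1) (a - 1) : ℂ) *
              doubleZeta (b + ω) (a + c - 2 * ξ - ω))
        + (-1 : ℂ) ^ b * (∑ ξ ∈ Finset.range (b / 2 + 1), riemannZeta ((2 * ξ : ℕ) : ℂ) *
          ∑ ω ∈ Finset.range (c - 1 + 1),
            (Nat.choose (ω + b - 2 * ξ) ω : ℂ) * (Nat.choose (a + c - ω - 2) (a - 1) : ℂ) *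
              doubleZeta (b - 2 * ξ + ω + 1) (a + c - 1 - ω)))
      - doubleZeta (a + b) c
      - (1 + (-1 : ℂ) ^ b) * doubleZeta b (a + c)
      - (-1 : ℂ) ^ b * doubleZeta (b + c) a := by
  have htotal := hasSum_threePole_pairs ha hb hc
  -- the sum over `l`, evaluated by residues, for fixed `m` and `n`
  have hinner : ∀ p : OrderedPair,
      HasSum (fun l : ℤ => (-1) ^ (b + c) * threePole 0 (p.1.1 : ℤ) (p.1.2 : ℤ) a b c l)
        (2 * (endpointPart a b c (doubleTerm p.1.1 p.1.2)
          + midpointPart a b c (doubleTerm p.1.1 p.1.2)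
          + (-1) ^ b * endpointPart c b a (doubleTerm ((p.1.2 - p.1.1 : ℕ) : ℂ) p.1.2)
          + (-1) ^ b * midpointPart c b a (doubleTerm ((p.1.2 - p.1.1 : ℕ) : ℂ) p.1.2))) := by
    intro p
    have hs := (htotal.summable.prod_factor p).hasSum
    have h := (hasSum_threePole (p := 0) (q := p.1.1) (r := p.1.2)
      (by have := p.2; omega) (by have := p.2; omega) (by have := p.2; omega) a b c
      (by omega)).mul_left ((-1) ^ (b + c))
    rw [mul_left_comm, neg_one_pow_mul_polarSum p.2.1 p.2.2 (by omega) (by omega)] at h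
    -- the family is summable, so its sum is also the symmetric one
    have hs' : HasSum _ _ (symmetricIcc ℤ) := hs.mono_left LeAtTop.le_atTop
    have hu := hs'.unique h
    rwa [hu] at hs
  have hD : ∀ s t, 1 ≤ s → 2 ≤ t →
      HasSum (fun p : OrderedPair => doubleTerm p.1.1 p.1.2 s t) (doubleZeta s t) :=
    fun s t => hasSum_doubleTerm
  have hR : ∀ s t, 1 ≤ s → 2 ≤ t → HasSum (fun p : OrderedPair =>
      doubleTerm ((p.1.2 - p.1.1 : ℕ) : ℂ) p.1.2 s t) (doubleZeta s t) :=
    fun s t => hasSum_doubleTerm_reflect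
  have hres := ((((hasSum_endpointPart hD a (by omega : 1 ≤ b) hc).add
    (hasSum_midpointPart hD b (by omega : 1 ≤ a) hc)).add
    ((hasSum_endpointPart hR c (by omega : 1 ≤ b) ha).mul_left ((-1) ^ b))).add
    ((hasSum_midpointPart hR b (by omega : 1 ≤ c) ha).mul_left ((-1) ^ b))).mul_left 2
  have key := (htotal.prod_fiberwise hinner).unique hres
  simp only [endpointPart, midpointPart, add_comm c] at key
  linear_combination key
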